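/- **Weak Direct Sum (classical).** Let $\mathcal X,\mathcal Y$ be nonempty finite sets, $\mathcal Z$ a set, and $f\subseteq\mathcal X\times\mathcal Y\times\mathcal Z$ a total relation (for all $(x,y)$ there is $z$ with $(x,y,z)\in f$). For $m\in\mathbb N$ let $f^{\oplus m}\subseteq\mathcal X^m\times\mathcal Y^m\times\mathcal Z^m$ be the relation of all $(x,y,z)$ with $(x_i,y_i,z_i)\in f$ for every $i\in\{1,\dots,m\}$. A deterministic two-way protocol lets Alice (who knows $x$) and Bob (who knows $y$) exchange bits in any number of rounds, after which Bob announces an answer that depends on $y$ and the transcript; its cost is the number of bits exchanged in the worst case. A one-way protocol consists of a single message from Alice to Bob, after which Bob announces the answer; its cost is the length of the message in bits. For a relation $g$ and a probability distribution $\mu$ on its pairs of inputs, let $\mathsf D^{\mu}(g)$ and $\mathsf D^{1,\mu}(g)$ be the least cost of a deterministic two-way, respectively one-way, protocol whose answer is wrong for $g$ with probability at most $1/3$ when the inputs are drawn from $\mu$. Put $$\mathsf R^{[\,]}(g)=\max_{\mu\text{ product}}\mathsf D^{\mu}(g),\qquad \mathsf R^{1,[\,]}(g)=\max_{\mu\text{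 product}}\mathsf D^{1,\mu}(g),$$ where the maxima are over all product distributions $\mu=\mu_A\times\mu_B$ of the two players' inputs. Then there is an absolute constant $\kappa>0$ such that for all such $\mathcal X,\mathcal Y,\mathcal Z,f$ and all $m\in\mathbb N$, $$\mathsf R^{[\,]}(f^{\oplus m})\;\ge\; m\cdot\kappa\,\log_2\mathsf R^{1,[\,]}(f),$$ where the right-hand side is read as $0$ if $\mathsf R^{1,[\,]}(f)=0$. -/

import Mathlib

namespace CommComplexity

/-- The `m`-fold direct sum of a relation `f ⊆ X × Y × Z`: given `m` inputs for each player, an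
answer is correct when it is correct in every one of the `m` coordinates. -/
def directSum {X Y Z : Type*} (f : X → Y → Z → Prop) (m : ℕ) :
    (Fin m → X) → (Fin m → Y) → (Fin m → Z) → Prop :=
  fun x y z => ∀ i, f (x i) (y i) (z i)

/-- The product probability distributions on a finite set `X × Y`, given by their mass functions. -/
def productDistributions (X Y : Type*) [Fintype X] [Fintype Y] : Set (X × Y → ℝ) :=
  {μ | ∃ p ∈ stdSimplex ℝ X, ∃ q ∈ stdSimplex ℝ Y, ∀ x y, μ (x, y) = p x * q y}

open Classical in
/-- The probability under `μ` that the (deterministic) answer `g x y` is wrong for `f`. -/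
noncomputable def distError {X Y Z : Type*} [Fintype X] [Fintype Y]
    (f : X → Y → Z → Prop) (μ : X × Y → ℝ) (g : X → Y → Z) : ℝ :=
  ∑ v : X × Y, if f v.1 v.2 (g v.1 v.2) then 0 else μ v

/-- Deterministic two-way protocols. At each internal node, the bits exchanged so far determine
who speaks next, and that player sends one bit depending on the own input. There is no restriction
on the number of rounds. At a leaf Bob, who knows the transcript and his input, gives the answer. -/
inductive Protocol (X Y Z : Type*) where
  | answer (out : Y → Z) : Protocol X Y Z
  | alice (bit : X → Bool) (next : Bool → Protocol X Y Z) : Protocol X Y Z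
  | bob (bit : Y → Bool) (next : Bool → Protocol X Y Z) : Protocol X Y Z

/-- Bob's answer when the protocol is run on the inputs `x` and `y`. -/
def Protocol.run {X Y Z : Type*} : Protocol X Y Z → X → Y → Z
  | .answer out, _, y => out y
  | .alice bit next, x, y => (next (bit x)).run x y
  | .bob bit next, x, y => (next (bit y)).run x y

/-- The communication of a two-way protocol: the number of bits exchanged in the worst case. -/
def Protocol.cost {X Y Z : Type*} : Protocol X Y Z → ℕ
  | .answer _ => 0
  | .alice _ next => max (next false).cost (next true).cost + 1
  | .bob _ next => max (next false).cost (next true).cost + 1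

/-- Deterministic one-way protocols with `c` bits of communication: Alice sends a single message of
`c` bits, and Bob answers. -/
structure OneWayProtocol (X Y Z : Type*) (c : ℕ) where
  message : X → (Fin c → Bool)
  out : (Fin c → Bool) → Y → Z

/-- Bob's answer when the one-way protocol is run on the inputs `x` and `y`. -/
def OneWayProtocol.run {X Y Z : Type*} {c : ℕ} (P : OneWayProtocol X Y Z c) (x : X) (y : Y) : Z :=
  P.out (P.message x) y

/-- `D^μ_ε(f)`: distributional two-way communication complexity with average error at most `ε`. -/
noncomputable def distComplexity {X Y Z : Type*} [Fintype X] [Fintype Y]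
    (f : X → Y → Z → Prop) (ε : ℝ) (μ : X × Y → ℝ) : ℕ :=
  sInf {c | ∃ P : Protocol X Y Z, P.cost = c ∧ distError f μ P.run ≤ ε}

/-- `D^{1,μ}_ε(f)`: distributional one-way communication complexity with average error at most
`ε`. -/
noncomputable def oneWayDistComplexity {X Y Z : Type*} [Fintype X] [Fintype Y]
    (f : X → Y → Z → Prop) (ε : ℝ) (μ : X × Y → ℝ) : ℕ :=
  sInf {c | ∃ P : OneWayProtocol X Y Z c, distError f μ P.run ≤ ε}

/-- `R^{[ ]}_ε(f)`: the maximum of `D^μ_ε(f)` over the product distributions `μ`. -/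
noncomputable def productComplexity {X Y Z : Type*} [Fintype X] [Fintype Y]
    (f : X → Y → Z → Prop) (ε : ℝ) : ℕ :=
  sSup (distComplexity f ε '' productDistributions X Y)

/-- `R^{1,[ ]}_ε(f)`: the maximum of `D^{1,μ}_ε(f)` over the product distributions `μ`. -/
noncomputable def oneWayProductComplexity {X Y Z : Type*} [Fintype X] [Fintype Y]
    (f : X → Y → Z → Prop) (ε : ℝ) : ℕ :=
  sSup (oneWayDistComplexity f ε '' productDistributions X Y)

/-! The infima and suprema above are attained for total relations on finite nonempty sets. -/

theorem distError_eq_zero {X Y Z : Type*} [Fintype X] [Fintype Y]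
    {f : X → Y → Z → Prop} (μ : X × Y → ℝ) {g : X → Y → Z} (hg : ∀ x y, f x y (g x y)) :
    distError f μ g = 0 := by
  simp [distError, hg]

theorem exists_oneWayProtocol {X Y Z : Type*} [Fintype X] [Nonempty X]
    {f : X → Y → Z → Prop} (hf : ∀ x y, ∃ z, f x y z) :
    ∃ P : OneWayProtocol X Y Z (Fintype.card X), ∀ x y, f x y (P.run x y) := by
  classical
  choose g hg using hf
  let e := Fintype.equivFin X
  let enc : X → (Fin (Fintype.card X) → Bool) := fun x i => decide (e x = i)
  have henc : Function.Injective enc := fun x x' h => by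
    have h2 := congrFun h (e x)
    simp only [enc, decide_true] at h2
    exact (e.injective (of_decide_eq_true h2.symm)).symm
  refine ⟨⟨enc, fun s y => g (Function.invFun enc s) y⟩, fun x y => ?_⟩
  simp only [OneWayProtocol.run, Function.leftInverse_invFun henc x]
  exact hg x y

theorem exists_protocol_of_oneWay {X Y Z : Type*} (c : ℕ) (message : X → (Fin c → Bool))
    (out : (Fin c → Bool) → Y → Z) :
    ∃ P : Protocol X Y Z, P.cost = c ∧ ∀ x y, P.run x y = out (message x) y := by
  induction c with
  | zero =>
    refine ⟨.answer (out Fin.elim0), rfl, fun x y => ?_⟩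
    simp only [Protocol.run]
    congr
    exact Subsingleton.elim _ _
  | succ c ih =>
    choose P hP using fun b : Bool =>
      ih (fun x => Fin.tail (message x)) (fun s => out (Fin.cons b s))
    refine ⟨.alice (fun x => message x 0) P, by simp [Protocol.cost, (hP _).1], fun x y => ?_⟩
    simp only [Protocol.run, (hP _).2, Fin.cons_self_tail]

theorem productDistributions_nonempty (X Y : Type*) [Fintype X] [Fintype Y] [Nonempty X]
    [Nonempty Y] : (productDistributions X Y).Nonempty := by
  classical
  obtain ⟨x⟩ := ‹Nonempty X›
  obtain ⟨y⟩ := ‹Nonempty Y›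
  exact ⟨fun v => (Pi.single x 1 : X → ℝ) v.1 * (Pi.single y 1 : Y → ℝ) v.2, _,
    single_mem_stdSimplex ℝ x, _, single_mem_stdSimplex ℝ y, fun _ _ => rfl⟩

theorem oneWayDistComplexity_spec {X Y Z : Type*} [Fintype X] [Fintype Y] [Nonempty X]
    {f : X → Y → Z → Prop} (hf : ∀ x y, ∃ z, f x y z) {ε : ℝ} (hε : 0 ≤ ε) (μ : X × Y → ℝ) :
    (∃ P : OneWayProtocol X Y Z (oneWayDistComplexity f ε μ), distError f μ P.run ≤ ε) ∧
      oneWayDistComplexity f ε μ ≤ Fintype.card X := by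
  obtain ⟨P, hP⟩ := exists_oneWayProtocol hf
  have h : Fintype.card X ∈ {c | ∃ P : OneWayProtocol X Y Z c, distError f μ P.run ≤ ε} :=
    ⟨P, (distError_eq_zero μ hP).trans_le hε⟩
  exact ⟨Nat.sInf_mem ⟨_, h⟩, Nat.sInf_le h⟩

theorem distComplexity_spec {X Y Z : Type*} [Fintype X] [Fintype Y] [Nonempty X]
    {f : X → Y → Z → Prop} (hf : ∀ x y, ∃ z, f x y z) {ε : ℝ} (hε : 0 ≤ ε) (μ : X × Y → ℝ) :
    (∃ P : Protocol X Y Z, P.cost = distComplexity f ε μ ∧ distError f μ P.run ≤ ε) ∧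
      distComplexity f ε μ ≤ Fintype.card X := by
  obtain ⟨P, hP⟩ := exists_oneWayProtocol hf
  obtain ⟨Q, hQ, hQP⟩ := exists_protocol_of_oneWay _ P.message P.out
  have h : Fintype.card X ∈ {c | ∃ P : Protocol X Y Z, P.cost = c ∧ distError f μ P.run ≤ ε} :=
    ⟨Q, hQ, (distError_eq_zero μ fun x y => by rw [hQP]; exact hP x y).trans_le hε⟩
  exact ⟨Nat.sInf_mem ⟨_, h⟩, Nat.sInf_le h⟩

theorem productComplexity_isGreatest {X Y Z : Type*} [Fintype X] [Fintype Y] [Nonempty X]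
    [Nonempty Y] {f : X → Y → Z → Prop} (hf : ∀ x y, ∃ z, f x y z) {ε : ℝ} (hε : 0 ≤ ε) :
    IsGreatest (distComplexity f ε '' productDistributions X Y) (productComplexity f ε) := by
  have hb : BddAbove (distComplexity f ε '' productDistributions X Y) :=
    ⟨Fintype.card X, by rintro _ ⟨μ, _, rfl⟩; exact (distComplexity_spec hf hε μ).2⟩
  exact ⟨Nat.sSup_mem ((productDistributions_nonempty X Y).image _) hb, fun _ h => le_csSup hb h⟩

theorem oneWayProductComplexity_isGreatest {X Y Z : Type*} [Fintype X] [Fintype Y] [Nonempty X]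
    [Nonempty Y] {f : X → Y → Z → Prop} (hf : ∀ x y, ∃ z, f x y z) {ε : ℝ} (hε : 0 ≤ ε) :
    IsGreatest (oneWayDistComplexity f ε '' productDistributions X Y)
      (oneWayProductComplexity f ε) := by
  have hb : BddAbove (oneWayDistComplexity f ε '' productDistributions X Y) :=
    ⟨Fintype.card X, by rintro _ ⟨μ, _, rfl⟩; exact (oneWayDistComplexity_spec hf hε μ).2⟩
  exact ⟨Nat.sSup_mem ((productDistributions_nonempty X Y).image _) hb, fun _ h => le_csSup hb h⟩

end CommComplexity

/-! Let C be the two-way cost for m copies. If the one-way complexity of `f` exceeds 3N, then some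
product distribution p × q satisfies `RectangleBound` with η = 1/N. Otherwise every product
distribution has a sizable rectangle on which Bob can answer well unaided, and removing such
rectangles one after another gives a one-way protocol with 3N bits
(`exists_oneWay_of_not_rectangleBound`).

On p^m × q^m, each leaf of a two-way protocol is a rectangle, described by weights a and b.
Coordinates are exposed one at a time, with Alice's weight a conditioned on the earlier coordinates
of x. A coordinate is bad if x_i is spiky (its conditional weight far exceeds its prior) or y_i is
lucky (one answer works for nearly all the non-spiky mass). If each bad coordinate is discounted by
1/2, every coordinate costs the success a factor 15/16 (`sum_success_badCount_le`). Bad coordinates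
are rare under the full product: Markov's inequality handles spikes and `RectangleBound` handles
luck, so an exponential moment controls their number (`sum_pow_badCount_le`). Together these bound
the success on a leaf by (39/40)^m times its measure plus (2/τ)^m, where τ is a small power of N
(`successMass_directSum_le`). Only the second term is multiplied by the number of leaves, at most
2^C, which forces C to be of order m log N.

Two regimes remain. For m < 50, simulating a two-way protocol by an exponentially longer one-way
protocol suffices. For bounded one-way complexity, repeating a single hard input of Bob gives C ≥
m/4. -/

namespace CommComplexity

/-! ### Success mass and the decomposition of a protocol into leaf rectangles -/

open Classical in
/-- The mass of correct answers of `g` under the product of the weights `a` and `b`. -/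
noncomputable def successMass {X Y Z : Type*} [Fintype X] [Fintype Y]
    (f : X → Y → Z → Prop) (a : X → ℝ) (b : Y → ℝ) (g : X → Y → Z) : ℝ :=
  ∑ x, ∑ y, a x * b y * (if f x y (g x y) then 1 else 0)

theorem distError_add_successMass {X Y Z : Type*} [Fintype X] [Fintype Y]
    (f : X → Y → Z → Prop) {μ : X × Y → ℝ} {p : X → ℝ} {q : Y → ℝ}
    (hμ : ∀ x y, μ (x, y) = p x * q y) (g : X → Y → Z) :
    distError f μ g + successMass f p q g = (∑ x, p x) * ∑ y, q y := by
  classical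
  rw [distError, successMass, Fintype.sum_prod_type, ← Finset.sum_add_distrib, Finset.sum_mul_sum]
  refine Finset.sum_congr rfl fun x _ => ?_
  rw [← Finset.sum_add_distrib]
  refine Finset.sum_congr rfl fun y _ => ?_
  simp only [hμ]
  split_ifs <;> simp

/-- A bound on the success within each leaf rectangle gives a bound on the success of a protocol. -/
theorem successMass_run_le {X Y Z : Type*} [Fintype X] [Fintype Y] {f : X → Y → Z → Prop}
    {p : X → ℝ} {q : Y → ℝ} {l e : ℝ} (he : 0 ≤ e)
    (hleaf : ∀ (a : X → ℝ) (b : Y → ℝ) (out : Y → Z), 0 ≤ a → a ≤ p → 0 ≤ b → b ≤ q →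
      successMass f a b (fun _ y => out y) ≤ l * ((∑ x, a x) * ∑ y, b y) + e)
    (P : Protocol X Y Z) : ∀ (a : X → ℝ) (b : Y → ℝ), 0 ≤ a → a ≤ p → 0 ≤ b → b ≤ q →
      successMass f a b P.run ≤ l * ((∑ x, a x) * ∑ y, b y) + 2 ^ P.cost * e := by
  classical
  induction P with
  | answer out =>
    intro a b ha hap hb hbq
    simpa [Protocol.cost] using! hleaf a b out ha hap hb hbq
  | alice bit next ih =>
    intro a b ha hap hb hbq
    let r : Bool → X → ℝ := fun v x => if bit x = v then a x else 0
    have hr0 : ∀ v, 0 ≤ r v := fun v x => by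
      simp only [r]; split_ifs; exacts [ha x, le_rfl]
    have hrp : ∀ v, r v ≤ p := fun v x => by
      simp only [r]; split_ifs; exacts [hap x, (ha x).trans (hap x)]
    have hsum : ∑ x, a x = ∑ x, r false x + ∑ x, r true x := by
      rw [← Finset.sum_add_distrib]
      exact Finset.sum_congr rfl fun x _ => by cases h : bit x <;> simp [r, h]
    have hsucc : successMass f a b (Protocol.alice bit next).run =
        successMass f (r false) b (next false).run + successMass f (r true) b (next true).run := by
      simp only [successMass]
      rw [← Finset.sum_add_distrib]
      refine Finset.sum_congr rfl fun x _ => ?_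
      rw [← Finset.sum_add_distrib]
      exact Finset.sum_congr rfl fun y _ => by cases h : bit x <;> simp [r, h, Protocol.run]
    have h0 := ih false (r false) b (hr0 _) (hrp _) hb hbq
    have h1 := ih true (r true) b (hr0 _) (hrp _) hb hbq
    have c0 : (2 : ℝ) ^ (next false).cost * e ≤
        2 ^ max (next false).cost (next true).cost * e := by
      gcongr; exacts [by norm_num, le_max_left _ _]
    have c1 : (2 : ℝ) ^ (next true).cost * e ≤
        2 ^ max (next false).cost (next true).cost * e := by
      gcongr; exacts [by norm_num, le_max_right _ _]
    rw [hsucc, hsum, Protocol.cost, pow_succ]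
    linarith
  | bob bit next ih =>
    intro a b ha hap hb hbq
    let r : Bool → Y → ℝ := fun v y => if bit y = v then b y else 0
    have hr0 : ∀ v, 0 ≤ r v := fun v y => by
      simp only [r]; split_ifs; exacts [hb y, le_rfl]
    have hrq : ∀ v, r v ≤ q := fun v y => by
      simp only [r]; split_ifs; exacts [hbq y, (hb y).trans (hbq y)]
    have hsum : ∑ y, b y = ∑ y, r false y + ∑ y, r true y := by
      rw [← Finset.sum_add_distrib]
      exact Finset.sum_congr rfl fun y _ => by cases h : bit y <;> simp [r, h]
    have hsucc : successMass f a b (Protocol.bob bit next).run =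
        successMass f a (r false) (next false).run + successMass f a (r true) (next true).run := by
      simp only [successMass]
      rw [← Finset.sum_add_distrib]
      refine Finset.sum_congr rfl fun x _ => ?_
      rw [← Finset.sum_add_distrib]
      exact Finset.sum_congr rfl fun y _ => by cases h : bit y <;> simp [r, h, Protocol.run]
    have h0 := ih false a (r false) ha hap (hr0 _) (hrq _)
    have h1 := ih true a (r true) ha hap (hr0 _) (hrq _)
    have c0 : (2 : ℝ) ^ (next false).cost * e ≤
        2 ^ max (next false).cost (next true).cost * e := by
      gcongr; exacts [by norm_num, le_max_left _ _]
    have c1 : (2 : ℝ) ^ (next true).cost * e ≤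
        2 ^ max (next false).cost (next true).cost * e := by
      gcongr; exacts [by norm_num, le_max_right _ _]
    rw [hsucc, hsum, Protocol.cost, pow_succ]
    linarith

/-! ### One-way protocols -/

/-- A one-way protocol whose messages come from a set of at most `2 ^ c` elements. -/
theorem exists_oneWayProtocol_of_card_le {X Y Z M : Type*} [Nonempty X] [Fintype M] {c : ℕ}
    (hM : Fintype.card M ≤ 2 ^ c) (message : X → M) (out : M → Y → Z) :
    ∃ P : OneWayProtocol X Y Z c, ∀ x y, P.run x y = out (message x) y := by
  obtain ⟨e⟩ : Nonempty (M ↪ (Fin c → Bool)) :=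
    Function.Embedding.nonempty_of_card_le (by simpa using hM)
  have : Nonempty M := ‹Nonempty X›.map message
  refine ⟨⟨fun x => e (message x), fun s y => out (Function.invFun e s) y⟩, fun x y => ?_⟩
  simp only [OneWayProtocol.run, Function.leftInverse_invFun e.injective (message x)]

/-- Alice can announce her bits for all nodes of the protocol tree at once. -/
theorem exists_oneWayProtocol_of_protocol {X Y Z : Type*} [Nonempty X] (P : Protocol X Y Z) :
    ∃ n, n + 1 ≤ 2 ^ P.cost ∧ ∃ Q : OneWayProtocol X Y Z n, ∀ x y, Q.run x y = P.run x y := by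
  induction P with
  | answer out => exact ⟨0, by simp [Protocol.cost], ⟨fun _ => Fin.elim0, fun _ => out⟩,
      fun _ _ => rfl⟩
  | alice bit next ih =>
    obtain ⟨n0, h0, Q0, hQ0⟩ := ih false
    obtain ⟨n1, h1, Q1, hQ1⟩ := ih true
    -- One bit per node of Alice: her bit here and the messages for both subtrees. A binary tree of
    -- this depth has at most `2 ^ cost - 1` internal nodes, hence the `n + 1` in the bound.
    obtain ⟨Q, hQ⟩ := exists_oneWayProtocol_of_card_le (c := 1 + n0 + n1)
      (M := Bool × (Fin n0 → Bool) × (Fin n1 → Bool)) (by simp [pow_add, mul_assoc])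
      (fun x => (bit x, Q0.message x, Q1.message x))
      (fun s y => cond s.1 (Q1.out s.2.2 y) (Q0.out s.2.1 y))
    refine ⟨1 + n0 + n1, ?_, Q, fun x y => ?_⟩
    · have c0 := Nat.pow_le_pow_right (n := 2) (by norm_num)
        (le_max_left (next false).cost (next true).cost)
      have c1 := Nat.pow_le_pow_right (n := 2) (by norm_num)
        (le_max_right (next false).cost (next true).cost)
      rw [Protocol.cost, pow_succ]
      omega
    · rw [hQ, Protocol.run]
      cases h : bit x
      · exact hQ0 x y
      · exact hQ1 x y
  | bob bit next ih =>
    obtain ⟨n0, h0, Q0, hQ0⟩ := ih false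
    obtain ⟨n1, h1, Q1, hQ1⟩ := ih true
    obtain ⟨Q, hQ⟩ := exists_oneWayProtocol_of_card_le (c := n0 + n1)
      (M := (Fin n0 → Bool) × (Fin n1 → Bool)) (by simp [pow_add])
      (fun x => (Q0.message x, Q1.message x))
      (fun s y => cond (bit y) (Q1.out s.2 y) (Q0.out s.1 y))
    refine ⟨n0 + n1, ?_, Q, fun x y => ?_⟩
    · have c0 := Nat.pow_le_pow_right (n := 2) (by norm_num)
        (le_max_left (next false).cost (next true).cost)
      have c1 := Nat.pow_le_pow_right (n := 2) (by norm_num)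
        (le_max_right (next false).cost (next true).cost)
      rw [Protocol.cost, pow_succ]
      omega
    · rw [hQ, Protocol.run]
      cases h : bit y
      · exact hQ0 x y
      · exact hQ1 x y

/-! ### Rectangles with small error yield one-way protocols -/

open Classical in
/-- Every rectangle on which Bob's answers depend on his input only has error mass at least a
quarter of its measure, up to `η`. -/
def RectangleBound {X Y Z : Type*} [Fintype X] [Fintype Y] (f : X → Y → Z → Prop)
    (p : X → ℝ) (q : Y → ℝ) (η : ℝ) : Prop :=
  ∀ (A : Finset X) (B : Finset Y) (g : Y → Z),
    ∑ x ∈ A, ∑ y ∈ B, p x * q y * (if f x y (g y) then 1 else 0) ≤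
      3 / 4 * ((∑ x ∈ A, p x) * ∑ y ∈ B, q y) + η

/-- If every product distribution has a large rectangle with small error, then a one-way protocol
in which Alice follows a path of such rectangles has small error. -/
theorem exists_oneWay_of_not_rectangleBound {X Y Z : Type*} [Fintype X] [Fintype Y] [Nonempty Z]
    {f : X → Y → Z → Prop} {η : ℝ} (hη : 0 < η) (hη1 : η ≤ 1)
    (hH : ∀ p ∈ stdSimplex ℝ X, ∀ q ∈ stdSimplex ℝ Y, ¬ RectangleBound f p q η) (d : ℕ) :
    ∀ (p : X → ℝ) (q : Y → ℝ), 0 ≤ p → 0 ≤ q → ∃ P : OneWayProtocol X Y Z d,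
      (3 / 4 - (1 - η) ^ d) * ((∑ x, p x) * ∑ y, q y) ≤ successMass f p q P.run := by
  classical
  induction d with
  | zero =>
    intro p q hp hq
    refine ⟨⟨fun _ => Fin.elim0, fun _ _ => Classical.arbitrary Z⟩, ?_⟩
    have h1 : 0 ≤ (∑ x, p x) * ∑ y, q y :=
      mul_nonneg (Finset.sum_nonneg fun x _ => hp x) (Finset.sum_nonneg fun y _ => hq y)
    have h2 : 0 ≤ successMass f p q (OneWayProtocol.run (c := 0)
        ⟨fun _ => Fin.elim0, fun _ _ => Classical.arbitrary Z⟩) := by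
      refine Finset.sum_nonneg fun x _ => Finset.sum_nonneg fun y _ => ?_
      have := hp x; have := hq y
      split_ifs <;> simp_all [mul_nonneg]
    -- With no bits the claimed coefficient is 3/4 - 1 < 0, so any answer will do.
    refine le_trans ?_ h2
    norm_num
    linarith
  | succ d ih =>
    intro p q hp hq
    have hs0 : 0 ≤ ∑ x, p x := Finset.sum_nonneg fun x _ => hp x
    have ht0 : 0 ≤ ∑ y, q y := Finset.sum_nonneg fun y _ => hq y
    set s := ∑ x, p x with hs
    set t := ∑ y, q y with ht
    have hnn : ∀ P : OneWayProtocol X Y Z (d + 1), 0 ≤ successMass f p q P.run := fun P => by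
      refine Finset.sum_nonneg fun x _ => Finset.sum_nonneg fun y _ => ?_
      have := hp x; have := hq y
      split_ifs <;> simp_all [mul_nonneg]
    rcases (mul_nonneg hs0 ht0).eq_or_lt with h0 | hpos
    · refine ⟨⟨fun _ _ => true, fun _ _ => Classical.arbitrary Z⟩, ?_⟩
      rw [← h0, mul_zero]
      exact hnn _
    have hs1 : s ≠ 0 := left_ne_zero_of_mul hpos.ne'
    have ht1 : t ≠ 0 := right_ne_zero_of_mul hpos.ne'
    have hsp : (fun x => p x / s) ∈ stdSimplex ℝ X :=
      ⟨fun x => div_nonneg (hp x) hs0, by rw [← Finset.sum_div]; exact div_self hs1⟩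
    have htq : (fun y => q y / t) ∈ stdSimplex ℝ Y :=
      ⟨fun y => div_nonneg (hq y) ht0, by rw [← Finset.sum_div]; exact div_self ht1⟩
    have := hH _ hsp _ htq
    simp only [RectangleBound, not_forall, not_le] at this
    obtain ⟨A, B, g, hABg⟩ := this
    have hscale : 3 / 4 * ((∑ x ∈ A, p x) * ∑ y ∈ B, q y) + η * (s * t) <
        ∑ x ∈ A, ∑ y ∈ B, p x * q y * (if f x y (g y) then 1 else 0) := by
      have e1 : ∑ x ∈ A, ∑ y ∈ B, p x / s * (q y / t) * (if f x y (g y) then (1 : ℝ) else 0) =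
          (∑ x ∈ A, ∑ y ∈ B, p x * q y * (if f x y (g y) then 1 else 0)) / (s * t) := by
        rw [Finset.sum_div]
        refine Finset.sum_congr rfl fun x _ => ?_
        rw [Finset.sum_div]
        exact Finset.sum_congr rfl fun y _ => by field_simp
      rw [e1, ← Finset.sum_div, ← Finset.sum_div, lt_div_iff₀ hpos] at hABg
      refine lt_of_eq_of_lt ?_ hABg
      field_simp
    obtain ⟨P0, hP0⟩ := ih (fun x => if x ∈ A then 0 else p x) q
      (fun x => by dsimp only; split_ifs; exacts [le_rfl, hp x]) hq
    obtain ⟨P1, hP1⟩ := ih (fun x => if x ∈ A then p x else 0) (fun y => if y ∈ B then 0 else q y)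
      (fun x => by dsimp only; split_ifs; exacts [hp x, le_rfl])
      (fun y => by dsimp only; split_ifs; exacts [le_rfl, hq y])
    -- If x ∈ A, Alice carries on in A × Bᶜ without knowing whether y ∈ B; if y ∈ B, Bob answers
    -- from `g` and ignores the remaining bits. So no reply is needed, and the unresolved part is
    -- the complement of A × B.
    let P : OneWayProtocol X Y Z (d + 1) :=
      ⟨fun x => Fin.cons (decide (x ∈ A)) (if x ∈ A then P1.message x else P0.message x),
        fun m y => if m 0 then if y ∈ B then g y else P1.out (Fin.tail m) y
          else P0.out (Fin.tail m) y⟩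
    have hrun : ∀ x y, P.run x y =
        if x ∈ A then if y ∈ B then g y else P1.run x y else P0.run x y := fun x y => by
      by_cases hx : x ∈ A <;> simp [P, OneWayProtocol.run, hx]
    have hsplit : successMass f p q P.run =
        successMass f (fun x => if x ∈ A then 0 else p x) q P0.run +
        successMass f (fun x => if x ∈ A then p x else 0) (fun y => if y ∈ B then 0 else q y)
          P1.run + ∑ x ∈ A, ∑ y ∈ B, p x * q y * (if f x y (g y) then 1 else 0) := by
      have e1 : ∑ x ∈ A, ∑ y ∈ B, p x * q y * (if f x y (g y) then (1 : ℝ) else 0) =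
          ∑ x, ∑ y, if x ∈ A then if y ∈ B then p x * q y * (if f x y (g y) then 1 else 0)
            else 0 else 0 := by
        have hind : ∀ F : X → ℝ, ∑ x ∈ A, F x = ∑ x, if x ∈ A then F x else 0 := fun F => by
          rw [Finset.sum_ite_mem, Finset.univ_inter]
        rw [hind]
        refine Finset.sum_congr rfl fun x _ => ?_
        by_cases hx : x ∈ A
        · simp only [hx, if_true]
          rw [Finset.sum_ite_mem, Finset.univ_inter]
        · simp [hx]
      rw [e1]
      simp only [successMass]
      rw [← Finset.sum_add_distrib, ← Finset.sum_add_distrib]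
      refine Finset.sum_congr rfl fun x _ => ?_
      rw [← Finset.sum_add_distrib, ← Finset.sum_add_distrib]
      refine Finset.sum_congr rfl fun y _ => ?_
      rw [hrun]
      by_cases hx : x ∈ A <;> by_cases hy : y ∈ B <;> simp [hx, hy]
    have hA : s = ∑ x ∈ A, p x + ∑ x, (if x ∈ A then 0 else p x) := by
      rw [← Finset.univ_inter A, ← Finset.sum_ite_mem, ← Finset.sum_add_distrib, hs]
      exact Finset.sum_congr rfl fun x _ => by by_cases hx : x ∈ A <;> simp [hx]
    have hB : t = ∑ y ∈ B, q y + ∑ y, (if y ∈ B then 0 else q y) := by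
      rw [← Finset.univ_inter B, ← Finset.sum_ite_mem, ← Finset.sum_add_distrib, ht]
      exact Finset.sum_congr rfl fun y _ => by by_cases hy : y ∈ B <;> simp [hy]
    have hA' : ∑ x, (if x ∈ A then p x else 0) = ∑ x ∈ A, p x := by
      rw [Finset.sum_ite_mem, Finset.univ_inter]
    have hmass : ∑ x ∈ A, ∑ y ∈ B, p x * q y * (if f x y (g y) then (1 : ℝ) else 0) ≤
        (∑ x ∈ A, p x) * ∑ y ∈ B, q y := by
      rw [Finset.sum_mul_sum]
      refine Finset.sum_le_sum fun x _ => Finset.sum_le_sum fun y _ => ?_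
      have := mul_nonneg (hp x) (hq y)
      split_ifs <;> simp [this]
    rw [hA'] at hP1
    refine ⟨P, ?_⟩
    rw [hsplit]
    set α := ∑ x ∈ A, p x
    set β := ∑ y ∈ B, q y
    set α' := ∑ x, (if x ∈ A then 0 else p x)
    set β' := ∑ y, (if y ∈ B then 0 else q y)
    have hpow : 0 ≤ (1 - η) ^ d := pow_nonneg (by linarith) _
    have h2 : 0 < η * (s * t) := mul_pos hη hpos
    -- The correct mass in A × B exceeds η s t, hence so does its measure: the unresolved mass
    -- shrinks by the factor 1 - η.
    have hlarge : η * (s * t) ≤ α * β := by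
      have : 0 ≤ α * β := mul_nonneg (Finset.sum_nonneg fun x _ => hp x)
        (Finset.sum_nonneg fun y _ => hq y)
      linarith
    have := mul_le_mul_of_nonneg_left hlarge hpow
    have hst : s * t = α' * t + α * β' + α * β := by rw [hA, hB]; ring
    have hP : (3 / 4 - (1 - η) ^ d) * (α' * t) + (3 / 4 - (1 - η) ^ d) * (α * β') +
        3 / 4 * (α * β) ≥ (3 / 4 - (1 - η) ^ (d + 1)) * (s * t) := by
      rw [pow_succ]
      have : (3 / 4 - (1 - η) ^ d) * (α' * t + α * β') =
        (3 / 4 - (1 - η) ^ d) * (s * t - α * β) := by rw [hst]; ring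
      linarith
    linarith

/-! ### Success of a rectangle under a product of m copies -/

section Product

variable {X Y Z : Type*} [Fintype X] [Fintype Y]

/-- The mass function of the `m`-fold product of a distribution. -/
def piMass (p : X → ℝ) {m : ℕ} (x : Fin m → X) : ℝ := ∏ i, p (x i)

theorem sum_finSucc {m : ℕ} (F : (Fin (m + 1) → X) → ℝ) :
    ∑ x, F x = ∑ x0, ∑ x', F (Fin.cons x0 x') := by
  rw [← (Fin.consEquiv fun _ => X).sum_comp, Fintype.sum_prod_type]
  rfl

omit [Fintype X] in
theorem piMass_cons (p : X → ℝ) {m : ℕ} (x0 : X) (x : Fin m → X) :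
    piMass p (Fin.cons x0 x : Fin (m + 1) → X) = p x0 * piMass p x := by
  simp [piMass, Fin.prod_univ_succ]

theorem piMass_mem_stdSimplex {p : X → ℝ} (hp : p ∈ stdSimplex ℝ X) (m : ℕ) :
    (piMass p : (Fin m → X) → ℝ) ∈ stdSimplex ℝ (Fin m → X) := by
  refine ⟨fun x => Finset.prod_nonneg fun i _ => hp.1 _, ?_⟩
  induction m with
  | zero => simp [piMass]
  | succ m ih => simp [sum_finSucc, piMass_cons, ← Finset.mul_sum, ih, hp.2]

omit [Fintype X] [Fintype Y] in
theorem directSum_cons (f : X → Y → Z → Prop) {m : ℕ} (x : Fin (m + 1) → X) (y : Fin (m + 1) → Y)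
    (z : Fin (m + 1) → Z) : directSum f (m + 1) x y z ↔
      f (x 0) (y 0) (z 0) ∧ directSum f m (Fin.tail x) (Fin.tail y) (Fin.tail z) := by
  simp only [directSum, Fin.forall_fin_succ, Fin.tail]

/-- The points whose mass under `c` exceeds the average density by a factor `M`. -/
def spike (p : X → ℝ) (M : ℝ) (c : X → ℝ) : Set X := {x | M * p x * ∑ x', c x' < c x}

open Classical in
/-- The inputs of Bob for which some answer is good for most of the non-spiky mass of `c`. -/
def lucky (f : X → Y → Z → Prop) (p : X → ℝ) (M : ℝ) (c : X → ℝ) : Set Y :=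
  {y | ∃ z, 7 / 8 * ∑ x, c x < ∑ x, if x ∉ spike p M c ∧ f x y z then c x else 0}

/-- The marginal of a weight on the first coordinate. -/
def marginal {m : ℕ} (a : (Fin (m + 1) → X) → ℝ) (x0 : X) : ℝ := ∑ x : Fin m → X, a (Fin.cons x0 x)

open Classical in
/-- The number of coordinates `i` such that, in the distribution `a` conditioned on the
coordinates of `x` before `i`, `x i` is spiky or `y i` is lucky. -/
noncomputable def badCount (f : X → Y → Z → Prop) (p : X → ℝ) (M : ℝ) :
    (m : ℕ) → ((Fin m → X) → ℝ) → (Fin m → X) → (Fin m → Y) → ℕ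
  | 0, _, _, _ => 0
  | m + 1, a, x, y =>
    (if x 0 ∈ spike p M (marginal a) ∨ y 0 ∈ lucky f p M (marginal a) then 1 else 0) +
      badCount f p M m (fun x' => a (Fin.cons (x 0) x')) (Fin.tail x) (Fin.tail y)

theorem marginal_nonneg {m : ℕ} {a : (Fin (m + 1) → X) → ℝ} (ha : 0 ≤ a) : 0 ≤ marginal a :=
  fun _ => Finset.sum_nonneg fun _ _ => ha _

open Classical in
-- Markov's inequality for the density of `c` relative to `p`. The strict inequality in `spike`
-- leaves no spikes when `c` vanishes.
theorem sum_spike_le {p : X → ℝ} {M : ℝ} (hM : 0 < M) {c : X → ℝ} (hc : 0 ≤ c) :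
    ∑ x, (if x ∈ spike p M c then p x else 0) ≤ 1 / M := by
  rcases (Finset.sum_nonneg fun x _ => hc x : 0 ≤ ∑ x, c x).eq_or_lt with h | h
  · have h0 := (Finset.sum_eq_zero_iff_of_nonneg fun x _ => hc x).1 h.symm
    refine le_trans (le_of_eq (Finset.sum_eq_zero fun x hx => if_neg ?_)) (by positivity)
    simp [spike, ← h, h0 x hx]
  · rw [le_div_iff₀ hM, ← mul_le_mul_iff_of_pos_right h, one_mul, mul_assoc, Finset.sum_mul]
    refine Finset.sum_le_sum fun x _ => ?_
    split_ifs with hx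
    · have : M * p x * ∑ x', c x' < c x := hx
      linarith
    · simpa using hc x

open Classical in
-- Off the spikes, `c` is at most M times its total times `p`, so an advantage over 3/4 under `c`
-- carries over to `p` with a loss of M. Lucky inputs have the advantage 7/8 - 3/4 = 1/8, while
-- `RectangleBound` caps the total advantage under `p` by η.
theorem sum_lucky_le [Nonempty Z] {f : X → Y → Z → Prop} {p : X → ℝ} (hp : 0 ≤ p) {q : Y → ℝ}
    (hq : 0 ≤ q) {η : ℝ} (hη : 0 ≤ η) (hH : RectangleBound f p q η) {M : ℝ} (hM : 0 < M)
    {c : X → ℝ} (hc : 0 ≤ c) :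
    ∑ y, (if y ∈ lucky f p M c then q y else 0) ≤ 8 * M * η := by
  have hpos8 : 0 ≤ 8 * M * η := by positivity
  rcases (Finset.sum_nonneg fun x _ => hc x : 0 ≤ ∑ x, c x).eq_or_lt with h | h
  · have h0 := (Finset.sum_eq_zero_iff_of_nonneg fun x _ => hc x).1 h.symm
    refine le_trans (le_of_eq (Finset.sum_eq_zero fun y _ => if_neg ?_)) hpos8
    rintro ⟨z, hz⟩
    rw [← h] at hz
    refine hz.ne ?_
    rw [mul_zero, Finset.sum_eq_zero]
    intro x hx
    simp [h0 x hx]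
  set s := ∑ x, c x with hs
  let c' : X → ℝ := fun x => if x ∈ spike p M c then 0 else c x
  have hc'0 : 0 ≤ c' := fun x => by simp only [c']; split_ifs; exacts [le_rfl, hc x]
  have hc'M : ∀ x, c' x ≤ M * s * p x := fun x => by
    simp only [c']
    split_ifs with hx
    · exact mul_nonneg (mul_nonneg hM.le h.le) (hp x)
    · have : ¬ M * p x * s < c x := hx
      linarith
  have hc's : ∑ x, c' x ≤ s := Finset.sum_le_sum fun x _ => by
    simp only [c']; split_ifs; exacts [hc x, le_rfl]
  have hg : ∀ y, ∃ z, y ∈ lucky f p M c → 7 / 8 * s < ∑ x, c' x * (if f x y z then 1 else 0) := by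
    intro y
    by_cases hy : y ∈ lucky f p M c
    · obtain ⟨z, hz⟩ := hy
      refine ⟨z, fun _ => hz.trans_le (le_of_eq (Finset.sum_congr rfl fun x _ => ?_))⟩
      by_cases h1 : x ∈ spike p M c <;> by_cases h2 : f x y z <;> simp [c', h1, h2]
    · exact ⟨Classical.arbitrary Z, fun h => (hy h).elim⟩
  choose g hg using hg
  let B : Finset Y := {y | y ∈ lucky f p M c}
  have hBsum : ∑ y, (if y ∈ lucky f p M c then q y else 0) = ∑ y ∈ B, q y := by
    rw [Finset.sum_filter]
  rw [hBsum]
  -- The advantage of `g` over 3/4 at x. Replacing `c'` by its upper bound is legitimate only where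
  -- this is positive; that set is the side `A` of the rectangle to be tested.
  let k : X → ℝ := fun x => ∑ y ∈ B, q y * ((if f x y (g y) then 1 else 0) - 3 / 4)
  let A : Finset X := {x | 0 < k x}
  have hupper : ∑ x, c' x * k x ≤ M * s * η := by
    calc ∑ x, c' x * k x ≤ ∑ x, if x ∈ A then M * s * (p x * k x) else 0 := by
          refine Finset.sum_le_sum fun x _ => ?_
          by_cases hx : 0 < k x
          · simp only [A, Finset.mem_filter, Finset.mem_univ, true_and, hx, if_true]
            have := mul_le_mul_of_nonneg_right (hc'M x) hx.le
            linarith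
          · simp only [A, Finset.mem_filter, Finset.mem_univ, true_and, hx, if_false]
            exact mul_nonpos_of_nonneg_of_nonpos (hc'0 x) (not_lt.1 hx)
      _ = M * s * ∑ x ∈ A, p x * k x := by
          rw [Finset.sum_ite_mem, Finset.univ_inter, ← Finset.mul_sum]
      _ ≤ M * s * η := by
          gcongr
          have := hH A B g
          have e : ∑ x ∈ A, p x * k x =
              ∑ x ∈ A, ∑ y ∈ B, p x * q y * (if f x y (g y) then 1 else 0) -
                3 / 4 * ((∑ x ∈ A, p x) * ∑ y ∈ B, q y) := by
            rw [Finset.sum_mul_sum, Finset.mul_sum, ← Finset.sum_sub_distrib]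
            refine Finset.sum_congr rfl fun x _ => ?_
            simp only [k]
            rw [Finset.mul_sum, Finset.mul_sum, ← Finset.sum_sub_distrib]
            exact Finset.sum_congr rfl fun y _ => by ring
          linarith
  have hlower : s / 8 * ∑ y ∈ B, q y ≤ ∑ x, c' x * k x := by
    have e : ∑ x, c' x * k x =
        ∑ y ∈ B, q y * (∑ x, c' x * (if f x y (g y) then 1 else 0) - 3 / 4 * ∑ x, c' x) := by
      simp only [k, Finset.mul_sum]
      rw [Finset.sum_comm]
      refine Finset.sum_congr rfl fun y _ => ?_
      rw [← Finset.sum_sub_distrib, Finset.mul_sum]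
      exact Finset.sum_congr rfl fun x _ => by ring
    rw [e, Finset.mul_sum]
    refine Finset.sum_le_sum fun y hy => ?_
    rw [mul_comm]
    have := hg y (by simpa [B] using hy)
    exact mul_le_mul_of_nonneg_left (by linarith) (hq y)
  have h3 := hlower.trans hupper
  have h4 : s * ∑ y ∈ B, q y ≤ s * (8 * M * η) := by linarith
  exact le_of_mul_le_mul_left h4 h

omit [Fintype Y] in
open Classical in
-- For fixed y and z, each coordinate contributes at most 15/16: if y_i is lucky, the discount alone
-- gives 1/2; if not, non-spiky successes have share at most 7/8 and the spiky ones are halved,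
-- giving 1/2 + 1/2 · 7/8.
theorem sum_success_badCount_le (f : X → Y → Z → Prop) (p : X → ℝ) (M : ℝ) {m : ℕ}
    (a : (Fin m → X) → ℝ) (ha : 0 ≤ a) (y : Fin m → Y) (z : Fin m → Z) :
    ∑ x, a x * ((if directSum f m x y z then 1 else 0) * (1 / 2) ^ badCount f p M m a x y) ≤
      (15 / 16) ^ m * ∑ x, a x := by
  induction m with
  | zero => simp [badCount, directSum]
  | succ m ih =>
    set c := marginal a with hc
    have hc0 : 0 ≤ c := marginal_nonneg ha
    have hsum : ∑ x, a x = ∑ x0, c x0 := sum_finSucc a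
    have hstep : ∀ x0, ∑ x', a (Fin.cons x0 x') *
        ((if directSum f (m + 1) (Fin.cons x0 x') y z then 1 else 0) *
          (1 / 2) ^ badCount f p M (m + 1) a (Fin.cons x0 x') y) ≤
        (15 / 16) ^ m * (c x0 * ((if f x0 (y 0) (z 0) then 1 else 0) *
          (1 / 2) ^ (if x0 ∈ spike p M c ∨ y 0 ∈ lucky f p M c then 1 else 0))) := by
      intro x0
      have h1 := ih (fun x' => a (Fin.cons x0 x')) (fun x' => ha _) (Fin.tail y) (Fin.tail z)
      have h2 : (0 : ℝ) ≤ (if f x0 (y 0) (z 0) then 1 else 0) *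
          (1 / 2) ^ (if x0 ∈ spike p M c ∨ y 0 ∈ lucky f p M c then 1 else 0) := by
        split_ifs <;> norm_num
      refine le_trans (le_of_eq ?_) ((mul_le_mul_of_nonneg_left h1 h2).trans (le_of_eq ?_))
      · rw [Finset.mul_sum]
        refine Finset.sum_congr rfl fun x' _ => ?_
        simp only [directSum_cons, badCount, pow_add, Fin.cons_zero, Fin.tail_cons, ← hc]
        by_cases h : f x0 (y 0) (z 0) <;>
          by_cases h' : directSum f m x' (Fin.tail y) (Fin.tail z) <;>
            simp [h, h', mul_comm, mul_left_comm]
      · rw [hc, marginal]; ring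
    have hone : ∑ x0, c x0 * ((if f x0 (y 0) (z 0) then 1 else 0) *
        (1 / 2) ^ (if x0 ∈ spike p M c ∨ y 0 ∈ lucky f p M c then 1 else 0)) ≤
        15 / 16 * ∑ x0, c x0 := by
      by_cases hy : y 0 ∈ lucky f p M c
      · rw [Finset.mul_sum]
        refine Finset.sum_le_sum fun x _ => ?_
        have := hc0 x
        simp only [Pi.zero_apply] at this
        by_cases h : f x (y 0) (z 0) <;> simp [h, hy] <;> linarith
      · have hy' : ∑ x, (if x ∉ spike p M c ∧ f x (y 0) (z 0) then c x else 0) ≤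
            7 / 8 * ∑ x, c x := by
          by_contra h
          exact hy ⟨z 0, not_le.1 h⟩
        have : ∑ x0, c x0 * ((if f x0 (y 0) (z 0) then 1 else 0) *
            (1 / 2) ^ (if x0 ∈ spike p M c ∨ y 0 ∈ lucky f p M c then 1 else 0)) ≤
            ∑ x, (1 / 2 * c x +
              1 / 2 * (if x ∉ spike p M c ∧ f x (y 0) (z 0) then c x else 0)) := by
          refine Finset.sum_le_sum fun x _ => ?_
          have := hc0 x
          simp only [Pi.zero_apply] at this
          by_cases h : f x (y 0) (z 0) <;> by_cases h' : x ∈ spike p M c <;>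
            simp [h, hy, h'] <;> linarith
        rw [Finset.sum_add_distrib, ← Finset.mul_sum, ← Finset.mul_sum] at this
        linarith
    rw [hsum, sum_finSucc]
    refine (Finset.sum_le_sum fun x0 _ => hstep x0).trans ?_
    rw [← Finset.mul_sum, pow_succ, mul_assoc]
    gcongr

/-- The spiky and lucky sets of a coordinate depend only on `a` and the earlier coordinates of x,
whereas under the product measure the new pair is independent of these. So the moment is bounded
coordinate by coordinate, each being bad with probability at most 1/M + 8Mη. -/
theorem sum_pow_badCount_le [Nonempty Z] {f : X → Y → Z → Prop} {p : X → ℝ}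
    (hp : p ∈ stdSimplex ℝ X) {q : Y → ℝ} (hq : q ∈ stdSimplex ℝ Y) {η : ℝ} (hη : 0 ≤ η)
    (hH : RectangleBound f p q η) {M : ℝ} (hM : 0 < M) {H : ℝ} (hH0 : 0 ≤ H) {m : ℕ}
    (a : (Fin m → X) → ℝ) (ha : 0 ≤ a) :
    ∑ x, ∑ y, piMass p x * piMass q y * H ^ badCount f p M m a x y ≤
      (1 + (1 / M + 8 * M * η) * H) ^ m := by
  classical
  induction m with
  | zero => simp [badCount, piMass]
  | succ m ih =>
    set c := marginal a with hc
    have hc0 : 0 ≤ c := marginal_nonneg ha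
    set K := 1 + (1 / M + 8 * M * η) * H with hK
    have hK0 : 0 ≤ K := by positivity
    let u : X → Y → ℝ := fun x0 y0 =>
      H ^ (if x0 ∈ spike p M c ∨ y0 ∈ lucky f p M c then 1 else 0)
    have hu0 : ∀ x0 y0, 0 ≤ u x0 y0 := fun _ _ => pow_nonneg hH0 _
    have hstep : ∑ x, ∑ y, piMass p x * piMass q y * H ^ badCount f p M (m + 1) a x y ≤
        ∑ x0, ∑ y0, p x0 * q y0 * u x0 y0 * K ^ m := by
      rw [sum_finSucc]
      refine Finset.sum_le_sum fun x0 _ => ?_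
      rw [Finset.sum_comm, sum_finSucc]
      refine Finset.sum_le_sum fun y0 _ => ?_
      have h1 := ih (fun x' => a (Fin.cons x0 x')) (fun x' => ha _)
      have h2 : 0 ≤ p x0 * q y0 * u x0 y0 :=
        mul_nonneg (mul_nonneg (hp.1 x0) (hq.1 y0)) (hu0 _ _)
      refine le_trans (le_of_eq ?_) (mul_le_mul_of_nonneg_left h1 h2)
      rw [Finset.sum_comm, Finset.mul_sum]
      refine Finset.sum_congr rfl fun x' _ => ?_
      rw [Finset.mul_sum]
      refine Finset.sum_congr rfl fun y' _ => ?_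
      simp only [piMass_cons, badCount, pow_add, Fin.cons_zero, Fin.tail_cons, ← hc, u]
      ring
    have hone : ∑ x0, ∑ y0, p x0 * q y0 * u x0 y0 ≤ K := by
      calc ∑ x0, ∑ y0, p x0 * q y0 * u x0 y0
          ≤ ∑ x0, ∑ y0, (p x0 * q y0 + H * ((if x0 ∈ spike p M c then p x0 else 0) * q y0) +
            H * (p x0 * (if y0 ∈ lucky f p M c then q y0 else 0))) := by
            refine Finset.sum_le_sum fun x0 _ => Finset.sum_le_sum fun y0 _ => ?_
            have h1 := mul_nonneg (hp.1 x0) (hq.1 y0)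
            have h2 := mul_nonneg hH0 h1
            by_cases hx : x0 ∈ spike p M c <;> by_cases hy : y0 ∈ lucky f p M c <;>
              simp [hx, hy, u] <;> linarith
        _ = 1 + H * ∑ x0, (if x0 ∈ spike p M c then p x0 else 0) +
            H * ∑ y0, (if y0 ∈ lucky f p M c then q y0 else 0) := by
            simp only [Finset.sum_add_distrib, ← Finset.mul_sum, ← Finset.sum_mul, hp.2, hq.2,
              mul_one, one_mul]
        _ ≤ 1 + H * (1 / M) + H * (8 * M * η) := by
            gcongr
            · exact sum_spike_le hM hc0
            · exact sum_lucky_le hp.1 hq.1 hη hH hM hc0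
        _ = K := by rw [hK]; ring
    refine hstep.trans ?_
    simp only [← Finset.sum_mul]
    rw [pow_succ, mul_comm]
    gcongr

/-- The success within a rectangle is exponentially small, up to a small additive error. -/
theorem successMass_directSum_le [Nonempty Z] {f : X → Y → Z → Prop} {p : X → ℝ}
    (hp : p ∈ stdSimplex ℝ X) {q : Y → ℝ} (hq : q ∈ stdSimplex ℝ Y) {η : ℝ} (hη : 0 ≤ η)
    (hH : RectangleBound f p q η) {M τ : ℝ} (hM : 0 < M) (hτ : 1 ≤ τ)
    (hν : (1 / M + 8 * M * η) * τ ^ 20 ≤ 1) {m : ℕ} (a : (Fin m → X) → ℝ) (b : (Fin m → Y) → ℝ)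
    (out : (Fin m → Y) → Fin m → Z) (ha : 0 ≤ a) (hap : a ≤ piMass p) (hb : 0 ≤ b)
    (hbq : b ≤ piMass q) :
    successMass (directSum f m) a b (fun _ y => out y) ≤
      (39 / 40) ^ m * ((∑ x, a x) * ∑ y, b y) + (2 / τ) ^ m := by
  classical
  have hτ0 : 0 < τ := by linarith
  let n := badCount f p M m a
  let w : (Fin m → X) → (Fin m → Y) → ℝ := fun x y =>
    if directSum f m x y (out y) then 1 else 0
  have hw0 : ∀ x y, 0 ≤ w x y := fun x y => by simp only [w]; split_ifs <;> norm_num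
  have hw1 : ∀ x y, w x y ≤ 1 := fun x y => by simp only [w]; split_ifs <;> norm_num
  have hpt : ∀ x y, a x * b y * w x y ≤
      (26 / 25) ^ m * (b y * (a x * (w x y * (1 / 2) ^ n x y))) +
        (1 / τ) ^ m * (piMass p x * piMass q y * (τ ^ 20) ^ n x y) := by
    intro x y
    have hab : 0 ≤ a x * b y := mul_nonneg (ha x) (hb y)
    have habw : 0 ≤ a x * b y * w x y := mul_nonneg hab (hw0 x y)
    have hpq : a x * b y ≤ piMass p x * piMass q y :=
      mul_le_mul (hap x) (hbq y) (hb y) ((ha x).trans (hap x))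
    have hpq0 := hab.trans hpq
    -- With at most m/20 bad coordinates, the discount is repaid by (26/25)^m, as (26/25)^20 ≥ 2,
    -- and 26/25 · 15/16 = 39/40. With more, τ^(20n) ≥ τ^m, and the moment bound applies after
    -- enlarging a ⊗ b to the full product.
    by_cases hn : 20 * n x y ≤ m
    · have h1 : (1 : ℝ) ≤ (26 / 25) ^ m * (1 / 2) ^ n x y := by
        calc (1 : ℝ) ≤ ((26 / 25) ^ 20 * (1 / 2)) ^ n x y := one_le_pow₀ (by norm_num)
          _ = (26 / 25) ^ (20 * n x y) * (1 / 2) ^ n x y := by rw [mul_pow, pow_mul]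
          _ ≤ _ := by gcongr; norm_num
      have h2 : 0 ≤ (1 / τ) ^ m * (piMass p x * piMass q y * (τ ^ 20) ^ n x y) := by positivity
      have := mul_le_mul_of_nonneg_left h1 habw
      linarith
    · have h1 : 1 ≤ (1 / τ) ^ m * (τ ^ 20) ^ n x y := by
        rw [one_div, inv_pow, ← pow_mul, inv_mul_eq_div, le_div_iff₀ (by positivity), one_mul]
        exact pow_le_pow_right₀ hτ (by omega)
      have h2 : 0 ≤ (26 / 25 : ℝ) ^ m * (b y * (a x * (w x y * (1 / 2) ^ n x y))) := by
        exact mul_nonneg (by positivity) (mul_nonneg (hb y) (mul_nonneg (ha x)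
          (mul_nonneg (hw0 x y) (by positivity))))
      have h3 := mul_le_mul_of_nonneg_left h1 hpq0
      have h4 : a x * b y * w x y ≤ a x * b y := mul_le_of_le_one_right hab (hw1 x y)
      linarith
  have hK : (1 / M + 8 * M * η) * τ ^ 20 + 1 ≤ 2 := by linarith
  calc successMass (directSum f m) a b (fun _ y => out y)
      ≤ ∑ x, ∑ y, ((26 / 25) ^ m * (b y * (a x * (w x y * (1 / 2) ^ n x y))) +
        (1 / τ) ^ m * (piMass p x * piMass q y * (τ ^ 20) ^ n x y)) :=
        Finset.sum_le_sum fun x _ => Finset.sum_le_sum fun y _ => hpt x y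
    _ = (26 / 25) ^ m * ∑ y, b y * ∑ x, a x * (w x y * (1 / 2) ^ n x y) +
        (1 / τ) ^ m * ∑ x, ∑ y, piMass p x * piMass q y * (τ ^ 20) ^ n x y := by
        simp only [Finset.sum_add_distrib, ← Finset.mul_sum]
        congr 2
        rw [Finset.sum_comm]
        simp only [← Finset.mul_sum]
    _ ≤ (26 / 25) ^ m * ∑ y, b y * ((15 / 16) ^ m * ∑ x, a x) + (1 / τ) ^ m * 2 ^ m := by
        gcongr with y _
        · exact hb y
        · exact sum_success_badCount_le f p M a ha y (out y)
        · refine (sum_pow_badCount_le hp hq hη hH hM (by positivity) a ha).trans ?_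
          gcongr
          linarith
    _ = (39 / 40) ^ m * ((∑ x, a x) * ∑ y, b y) + (2 / τ) ^ m := by
        rw [← Finset.sum_mul, show (39 / 40 : ℝ) = 26 / 25 * (15 / 16) by norm_num,
          mul_pow, div_eq_mul_one_div, mul_pow]
        ring

end Product

/-! ### Lower bounds on the complexity of the direct sum -/

section Bounds

variable {X Y Z : Type*} [Fintype X] [Fintype Y] [Nonempty X] [Nonempty Y]
  {f : X → Y → Z → Prop}

theorem exists_protocol_of_product (hf : ∀ x y, ∃ z, f x y z) {p : X → ℝ}
    (hp : p ∈ stdSimplex ℝ X) {q : Y → ℝ} (hq : q ∈ stdSimplex ℝ Y) :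
    ∃ P : Protocol X Y Z, P.cost ≤ productComplexity f (1 / 3) ∧
      2 / 3 ≤ successMass f p q P.run := by
  let μ : X × Y → ℝ := fun v => p v.1 * q v.2
  obtain ⟨P, hPc, hPe⟩ := (distComplexity_spec hf (by norm_num : (0 : ℝ) ≤ 1 / 3) μ).1
  refine ⟨P, hPc.trans_le ((productComplexity_isGreatest hf (by norm_num)).2
    ⟨μ, ⟨p, hp, q, hq, fun _ _ => rfl⟩, rfl⟩), ?_⟩
  have := distError_add_successMass f (μ := μ) (fun _ _ => rfl) P.run
  rw [hp.2, hq.2] at this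
  linarith

theorem oneWayProductComplexity_le (hf : ∀ x y, ∃ z, f x y z) {c : ℕ}
    (h : ∀ p ∈ stdSimplex ℝ X, ∀ q ∈ stdSimplex ℝ Y, ∃ n ≤ c, ∃ P : OneWayProtocol X Y Z n,
      2 / 3 ≤ successMass f p q P.run) : oneWayProductComplexity f (1 / 3) ≤ c := by
  obtain ⟨μ, ⟨p, hp, q, hq, hμ⟩, hR⟩ :=
    (oneWayProductComplexity_isGreatest hf (by norm_num : (0 : ℝ) ≤ 1 / 3)).1
  obtain ⟨n, hn, P, hP⟩ := h p hp q hq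
  rw [← hR]
  refine le_trans (Nat.sInf_le ⟨P, ?_⟩) hn
  have := distError_add_successMass f hμ P.run
  rw [hp.2, hq.2] at this
  linarith

open Classical in
/-- The image of a distribution under a map. -/
noncomputable def pushMass {X' : Type*} (φ : X → X') (p : X → ℝ) (x' : X') : ℝ :=
  ∑ x, if x' = φ x then p x else 0

omit [Nonempty X] in
theorem sum_pushMass_mul {X' : Type*} [Fintype X'] (φ : X → X') (p : X → ℝ) (F : X' → ℝ) :
    ∑ x', pushMass φ p x' * F x' = ∑ x, p x * F (φ x) := by
  classical
  simp only [pushMass, Finset.sum_mul]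
  rw [Finset.sum_comm]
  simp

omit [Nonempty X] in
theorem pushMass_mem_stdSimplex {X' : Type*} [Fintype X'] (φ : X → X') {p : X → ℝ}
    (hp : p ∈ stdSimplex ℝ X) : pushMass φ p ∈ stdSimplex ℝ X' := by
  refine ⟨fun x' => Finset.sum_nonneg fun x _ => ?_, ?_⟩
  · split_ifs; exacts [hp.1 x, le_rfl]
  · simpa [hp.2] using sum_pushMass_mul φ p fun _ => 1

/-- One-way complexity is at most exponential in the two-way complexity of a relation that `f`
embeds in. -/
theorem oneWayProductComplexity_le_two_pow {X' Y' Z' : Type*} [Fintype X'] [Fintype Y']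
    {f' : X' → Y' → Z' → Prop} (hf : ∀ x y, ∃ z, f x y z)
    (hf' : ∀ x y, ∃ z, f' x y z) (φ : X → X') (ψ : Y → Y') (π : Z' → Z)
    (h : ∀ x y z, f' (φ x) (ψ y) z → f x y (π z)) :
    oneWayProductComplexity f (1 / 3) ≤ 2 ^ productComplexity f' (1 / 3) := by
  classical
  have : Nonempty X' := ‹Nonempty X›.map φ
  have : Nonempty Y' := ‹Nonempty Y›.map ψ
  refine oneWayProductComplexity_le hf fun p hp q hq => ?_
  obtain ⟨P, hPc, hPs⟩ := exists_protocol_of_product hf' (pushMass_mem_stdSimplex φ hp)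
    (pushMass_mem_stdSimplex ψ hq)
  obtain ⟨n, hn, Q, hQ⟩ := exists_oneWayProtocol_of_protocol P
  have hn' := Nat.pow_le_pow_right (n := 2) (by norm_num) hPc
  refine ⟨n, by omega, ⟨fun x => Q.message (φ x), fun s y => π (Q.out s (ψ y))⟩, hPs.trans ?_⟩
  have e : successMass f' (pushMass φ p) (pushMass ψ q) P.run =
      ∑ x, ∑ y, p x * q y * (if f' (φ x) (ψ y) (P.run (φ x) (ψ y)) then 1 else 0) := by
    simp only [successMass, mul_assoc, ← Finset.mul_sum, sum_pushMass_mul]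
  rw [e]
  refine Finset.sum_le_sum fun x _ => Finset.sum_le_sum fun y _ => ?_
  refine mul_le_mul_of_nonneg_left ?_ (mul_nonneg (hp.1 x) (hq.1 y))
  rw [← hQ]
  by_cases hg : f' (φ x) (ψ y) (Q.run (φ x) (ψ y))
  · rw [if_pos hg, if_pos]
    exact h _ _ _ hg
  · rw [if_neg hg]
    split_ifs <;> norm_num

omit [Fintype X] [Fintype Y] [Nonempty X] [Nonempty Y] in
theorem directSum_total (hf : ∀ x y, ∃ z, f x y z) (m : ℕ) :
    ∀ x y, ∃ z, directSum f m x y z := fun x y => by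
  choose g hg using hf
  exact ⟨fun i => g (x i) (y i), fun i => hg _ _⟩

/-- A single instance embeds as m equal copies, with the answer read off the first coordinate. -/
theorem oneWayProductComplexity_le_two_pow_directSum (hf : ∀ x y, ∃ z, f x y z) {m : ℕ}
    (hm : 0 < m) :
    oneWayProductComplexity f (1 / 3) ≤ 2 ^ productComplexity (directSum f m) (1 / 3) :=
  oneWayProductComplexity_le_two_pow hf (directSum_total hf m) (fun x _ => x) (fun y _ => y)
    (fun z => z ⟨0, hm⟩) fun _ _ _ h => h ⟨0, hm⟩

open Classical in
/-- If `f` has no good zero-communication protocol for some product distribution, then some input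
of Bob is already hard. -/
theorem exists_hard_input (hf : ∀ x y, ∃ z, f x y z)
    (hR : 0 < oneWayProductComplexity f (1 / 3)) :
    ∃ p ∈ stdSimplex ℝ X, ∃ y, ∀ z, ∑ x, p x * (if f x y z then 1 else 0) ≤ 2 / 3 := by
  by_contra! hcon
  refine hR.ne' (Nat.le_zero.1 (oneWayProductComplexity_le hf fun p hp q hq => ?_))
  choose g hg using hcon p hp
  refine ⟨0, le_rfl, ⟨fun _ => Fin.elim0, fun _ => g⟩, ?_⟩
  calc (2 / 3 : ℝ) = ∑ y, q y * (2 / 3) := by rw [← Finset.sum_mul, hq.2, one_mul]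
    _ ≤ ∑ y, q y * ∑ x, p x * (if f x y (g y) then 1 else 0) := by
        gcongr with y _
        · exact hq.1 y
        · exact (hg y).le
    _ = _ := by
        simp only [successMass, OneWayProtocol.run, Finset.mul_sum]
        rw [Finset.sum_comm]
        refine Finset.sum_congr rfl fun x _ => Finset.sum_congr rfl fun y _ => ?_
        by_cases h : f x y (g y) <;> simp [h, mul_comm]

/-- With Bob's input fixed to m copies of a hard one, an answer in Z^m is right with probability at
most (2/3)^m, so at most 2^C leaves must make up for this. -/
theorem le_four_mul_productComplexity_directSum (hf : ∀ x y, ∃ z, f x y z)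
    (hR : 0 < oneWayProductComplexity f (1 / 3)) {m : ℕ} (hm : 2 ≤ m) :
    m ≤ 4 * productComplexity (directSum f m) (1 / 3) := by
  classical
  obtain ⟨p, hp, y0, hy0⟩ := exists_hard_input hf hR
  have hpm := piMass_mem_stdSimplex hp m
  have hqm := single_mem_stdSimplex ℝ (fun _ : Fin m => y0)
  obtain ⟨P, hPc, hPs⟩ := exists_protocol_of_product (directSum_total hf m) hpm hqm
  have hleaf : ∀ (a : (Fin m → X) → ℝ) (b : (Fin m → Y) → ℝ) (out : (Fin m → Y) → Fin m → Z),
      0 ≤ a → a ≤ piMass p → 0 ≤ b → b ≤ Pi.single (fun _ : Fin m => y0) 1 →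
      successMass (directSum f m) a b (fun _ y => out y) ≤
        0 * ((∑ x, a x) * ∑ y, b y) + (2 / 3) ^ m := by
    intro a b out ha hap hb hbq
    rw [zero_mul, zero_add]
    set z := out fun _ => y0
    calc successMass (directSum f m) a b (fun _ y => out y)
        ≤ ∑ x, ∑ y, piMass p x * (Pi.single (fun _ : Fin m => y0) 1 : (Fin m → Y) → ℝ) y *
            (if directSum f m x y (out y) then 1 else 0) := by
          refine Finset.sum_le_sum fun x _ => Finset.sum_le_sum fun y _ => ?_
          refine mul_le_mul_of_nonneg_right ?_ (by split_ifs <;> norm_num)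
          exact mul_le_mul (hap x) (hbq y) (hb y) (hpm.1 x)
      _ = ∑ x, piMass p x * (if directSum f m x (fun _ => y0) z then 1 else 0) := by
          refine Finset.sum_congr rfl fun x _ => ?_
          rw [Finset.sum_eq_single (fun _ => y0)]
          · simp [z]
          · intro y _ hy
            simp [hy]
          · simp
      _ = ∑ x : Fin m → X, ∏ i, p (x i) * (if f (x i) y0 (z i) then 1 else 0) := by
          refine Finset.sum_congr rfl fun x _ => ?_
          rw [Finset.prod_mul_distrib, Finset.prod_ite_zero]
          by_cases h : ∀ i, f (x i) y0 (z i) <;> simp [piMass, directSum, h]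
      _ = ∏ i, ∑ x, p x * (if f x y0 (z i) then 1 else 0) := by
          rw [Finset.prod_univ_sum, Fintype.piFinset_univ]
      _ ≤ ∏ _i : Fin m, (2 / 3 : ℝ) := by
          refine Finset.prod_le_prod (fun i _ => Finset.sum_nonneg fun x _ => ?_)
            fun i _ => hy0 (z i)
          exact mul_nonneg (hp.1 x) (by split_ifs <;> norm_num)
      _ = (2 / 3) ^ m := by rw [Finset.prod_const, Finset.card_univ, Fintype.card_fin]
  have h1 := hPs.trans (successMass_run_le (by positivity) hleaf P _ _ hpm.1 le_rfl hqm.1 le_rfl)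
  rw [zero_mul, zero_add] at h1
  set C := productComplexity (directSum f m) (1 / 3)
  have h2 : (2 / 3 : ℝ) ≤ 2 ^ C * (2 / 3) ^ m :=
    h1.trans (by gcongr; norm_num)
  by_contra! hlt
  -- The required success 2/3 cancels one factor of (2/3)^m. If 4C ≤ k, the fourth power is at most
  -- (2 · 16/81)^k < 1, which needs k > 0.
  obtain ⟨k, rfl⟩ : ∃ k, m = k + 1 := ⟨m - 1, by omega⟩
  have h3 : (1 : ℝ) ≤ 2 ^ C * (2 / 3) ^ k := by
    rw [pow_succ] at h2
    linarith
  have h4 : (1 : ℝ) ≤ 2 ^ (4 * C) * (16 / 81) ^ k := by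
    calc (1 : ℝ) ≤ (2 ^ C * (2 / 3) ^ k) ^ 4 := one_le_pow₀ h3
      _ = 2 ^ (4 * C) * (16 / 81) ^ k := by
        rw [mul_pow, ← pow_mul, ← pow_mul, mul_comm k 4, pow_mul (2 / 3 : ℝ) 4 k, mul_comm C 4]
        norm_num
  have h5 : (2 : ℝ) ^ (4 * C) * (16 / 81) ^ k ≤ (32 / 81) ^ k := by
    calc (2 : ℝ) ^ (4 * C) * (16 / 81) ^ k ≤ 2 ^ k * (16 / 81) ^ k := by
          gcongr
          · norm_num
          · omega
      _ = (32 / 81) ^ k := by rw [← mul_pow]; norm_num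
  have h6 : (32 / 81 : ℝ) ^ k < 1 := pow_lt_one₀ (by norm_num) (by norm_num) (by omega)
  linarith

theorem exists_rectangleBound (hf : ∀ x y, ∃ z, f x y z) {N : ℕ} (hN : 0 < N)
    (hR : 3 * N < oneWayProductComplexity f (1 / 3)) :
    ∃ p ∈ stdSimplex ℝ X, ∃ q ∈ stdSimplex ℝ Y, RectangleBound f p q (1 / N) := by
  by_contra! hcon
  have : Nonempty Z := by
    obtain ⟨x⟩ := ‹Nonempty X›
    obtain ⟨y⟩ := ‹Nonempty Y›
    exact ⟨(hf x y).choose⟩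
  have hN' : (1 : ℝ) ≤ N := by exact_mod_cast hN
  refine hR.not_ge (oneWayProductComplexity_le hf fun p hp q hq => ?_)
  obtain ⟨P, hP⟩ := exists_oneWay_of_not_rectangleBound (f := f) (η := 1 / N) (by positivity)
    (by rw [div_le_one (by positivity)]; exact hN') hcon (3 * N) p q hp.1 hq.1
  refine ⟨3 * N, le_rfl, P, le_trans ?_ hP⟩
  rw [hp.2, hq.2, mul_one, mul_one]
  -- The unresolved share may be at most 3/4 - 2/3 = 1/12; 3N rounds leave at most e⁻³.
  have h1 : (1 - 1 / (N : ℝ)) ^ (3 * N) ≤ Real.exp (-3) := by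
    calc (1 - 1 / (N : ℝ)) ^ (3 * N) ≤ Real.exp (-(1 / N)) ^ (3 * N) := by
          gcongr
          · rw [sub_nonneg, div_le_one (by positivity)]; exact hN'
          · exact Real.one_sub_le_exp_neg _
      _ = Real.exp (-3) := by
          rw [← Real.exp_nat_mul]
          congr 1
          push_cast
          field_simp
  have h2 : Real.exp (-3) ≤ 1 / 12 := by
    have h := Real.exp_one_gt_d9
    have h' : (12 : ℝ) ≤ Real.exp 1 ^ 3 := by
      calc (12 : ℝ) ≤ 2.7 ^ 3 := by norm_num
        _ ≤ _ := by gcongr; linarith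
    rw [← Real.exp_nat_mul] at h'
    rw [Real.exp_neg, one_div]
    exact inv_anti₀ (by norm_num) (by simpa using h')
  linarith

theorem mul_le_productComplexity_directSum (hf : ∀ x y, ∃ z, f x y z) (j : ℕ)
    (hR : 3 * 2 ^ (40 * j + 8) < oneWayProductComplexity f (1 / 3)) {m : ℕ} (hm : 50 ≤ m) :
    j * m ≤ productComplexity (directSum f m) (1 / 3) + 2 * m := by
  have : Nonempty Z := by
    obtain ⟨x⟩ := ‹Nonempty X›
    obtain ⟨y⟩ := ‹Nonempty Y›
    exact ⟨(hf x y).choose⟩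
  obtain ⟨p, hp, q, hq, hH⟩ := exists_rectangleBound hf (by positivity) hR
  have hpm := piMass_mem_stdSimplex hp m
  have hqm := piMass_mem_stdSimplex hq m
  obtain ⟨P, hPc, hPs⟩ := exists_protocol_of_product (directSum_total hf m) hpm hqm
  -- Here τ = 2^j, M = 2^(20j+4) and η = 1/M², so the left side is (9/M) · 2^(20j) = 9/16.
  have hν : (1 / 2 ^ (20 * j + 4) + 8 * 2 ^ (20 * j + 4) * (1 / ((2 ^ (40 * j + 8) : ℕ) : ℝ))) *
      ((2 : ℝ) ^ j) ^ 20 ≤ 1 := by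
    have e1 : ((2 ^ (40 * j + 8) : ℕ) : ℝ) = 2 ^ (20 * j + 4) * 2 ^ (20 * j + 4) := by
      rw [← pow_add]; push_cast; congr 1; ring
    have e2 : ((2 : ℝ) ^ j) ^ 20 = 2 ^ (20 * j) := by rw [← pow_mul, mul_comm]
    rw [e1, e2, pow_add]
    have : (0 : ℝ) < 2 ^ (20 * j) := by positivity
    field_simp
    norm_num
  have h1 := hPs.trans (successMass_run_le (by positivity)
    (fun a b out ha hap hb hbq => successMass_directSum_le hp hq (by positivity) hH
      (by positivity) (one_le_pow₀ one_le_two) hν a b out ha hap hb hbq)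
    P _ _ hpm.1 le_rfl hqm.1 le_rfl)
  rw [hpm.2, hqm.2, mul_one, mul_one] at h1
  set C := productComplexity (directSum f m) (1 / 3)
  -- This is where m ≥ 50 enters: the multiplicative term can supply at most half of the success
  -- 2/3.
  have h2 : (39 / 40 : ℝ) ^ m ≤ 1 / 3 :=
    (pow_le_pow_of_le_one (by norm_num) (by norm_num) hm).trans (by norm_num)
  have h3 : (2 : ℝ) ^ P.cost ≤ 2 ^ C := pow_le_pow_right₀ one_le_two hPc
  have h4 : (1 / 3 : ℝ) ≤ 2 ^ C * (2 / 2 ^ j) ^ m := by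
    have : (2 : ℝ) ^ P.cost * (2 / 2 ^ j) ^ m ≤ 2 ^ C * (2 / 2 ^ j) ^ m := by gcongr
    linarith
  have h5 : (2 : ℝ) ^ (j * m) < 2 ^ (C + m + 2) := by
    rw [div_pow, ← pow_mul, ← mul_div_assoc, le_div_iff₀ (by positivity), ← pow_add] at h4
    have : (0 : ℝ) < 2 ^ (C + m) := by positivity
    rw [pow_add _ (C + m) 2]
    linarith
  have h6 := (pow_lt_pow_iff_right₀ (one_lt_two : (1 : ℝ) < 2)).1 h5
  omega

end Bounds

end CommComplexity

/-! ### Combining the regimes -/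

theorem mainTheorem9 :
    ∃ κ : ℝ, 0 < κ ∧
      ∀ (X Y Z : Type*) [Fintype X] [Fintype Y] [Nonempty X] [Nonempty Y]
        (f : X → Y → Z → Prop), (∀ x y, ∃ z, f x y z) →
      ∀ m : ℕ,
        (m : ℝ) * (κ * Real.logb 2 (CommComplexity.oneWayProductComplexity f (1 / 3))) ≤
          (CommComplexity.productComplexity (CommComplexity.directSum f m) (1 / 3) : ℝ) := by
  refine ⟨1 / 1000, by norm_num, fun X Y Z _ _ _ _ f hf m => ?_⟩
  set R := CommComplexity.oneWayProductComplexity f (1 / 3) with hR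
  set C := CommComplexity.productComplexity (CommComplexity.directSum f m) (1 / 3) with hC
  rcases Nat.eq_zero_or_pos R with hR0 | hR0
  · simp [hR0]
  rcases Nat.eq_zero_or_pos m with rfl | hm0
  · simp
  have hRpos : (0 : ℝ) < R := by exact_mod_cast hR0
  have hm1 : (1 : ℝ) ≤ m := by exact_mod_cast hm0
  rcases lt_or_ge m 50 with hm | hm
  · have h1 : (R : ℝ) ≤ 2 ^ C := by
      exact_mod_cast CommComplexity.oneWayProductComplexity_le_two_pow_directSum hf hm0
    have h2 : Real.logb 2 R ≤ C := by
      rw [Real.logb_le_iff_le_rpow one_lt_two hRpos, Real.rpow_natCast]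
      exact h1
    have h3 : (m : ℝ) ≤ 50 := by exact_mod_cast hm.le
    have h4 : (0 : ℝ) ≤ C := Nat.cast_nonneg _
    nlinarith
  · set n := Nat.log 2 R
    have hL : Real.logb 2 R ≤ n + 1 := by
      rw [Real.logb_le_iff_le_rpow one_lt_two hRpos]
      have := (Nat.lt_pow_succ_log_self one_lt_two R).le
      exact_mod_cast this
    have h1 : (m : ℝ) ≤ 4 * C := by
      exact_mod_cast CommComplexity.le_four_mul_productComplexity_directSum hf hR0
        (by omega : 2 ≤ m)
    -- The threshold 130 = 40 · 3 + 10 ensures j ≥ 3 below, so that (j - 2) m ≤ C is still a bound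
    -- of order j m.
    rcases lt_or_ge n 130 with hn | hn
    · have h2 : (n : ℝ) + 1 ≤ 130 := by exact_mod_cast hn
      nlinarith
    -- The two spare powers of 2 give 3 · 2^(40j+8) < 4 · 2^(40j+8) ≤ R.
    · obtain ⟨j, hj1, hj2⟩ : ∃ j, 40 * j + 10 ≤ n ∧ n < 40 * j + 50 :=
        ⟨(n - 10) / 40, by omega, by omega⟩
      have h2 : 3 * 2 ^ (40 * j + 8) < R := by
        have h3 : 2 ^ (40 * j + 10) ≤ R :=
          (Nat.pow_le_pow_right (by norm_num) hj1).trans (Nat.pow_log_le_self 2 hR0.ne')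
        rw [show 40 * j + 10 = 40 * j + 8 + 2 by ring, pow_add] at h3
        have : 0 < 2 ^ (40 * j + 8) := by positivity
        omega
      have h3 : (j : ℝ) * m ≤ C + 2 * m := by
        exact_mod_cast CommComplexity.mul_le_productComplexity_directSum hf j h2 hm
      have h4 : (n : ℝ) + 1 ≤ 40 * j + 50 := by exact_mod_cast hj2
      have h5 : (3 : ℝ) ≤ j := by
        have : 3 ≤ j := by omega
        exact_mod_cast this
      nlinarith
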